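/- Let $\mathbb{CP}(1)$ carry the Fubini–Study form, given in the affine coordinate $w\leftrightarrow[1,w]$ by $\Omega=\frac{i}{(1+|w|^2)^2}\,dw\wedge d\bar w$, of total mass $2\pi$, and let $\mu=\frac1{2\pi}\Omega$ be the normalized probability measure. For $m\ge 0$ let $\Gamma_2^m$ be the Hilbert space of square-integrable sections of the $m$-th tensor power of the hyperplane bundle, with inner product, in the coordinate $w$, $\langle s_1,s_2\rangle=\int_{\mathbb C}\frac{s_1(w)\overline{s_2(w)}}{(1+|w|^2)^m}\,\Omega$; let $\Gamma_{hol}^m=\mathrm{span}\{1,w,\dots,w^m\}$ be the subspace of holomorphic sections and $P^m$ the orthogonal projection of $\Gamma_2^m$ onto $\Gamma_{hol}^m$. Let $f$ be a real $C^\infty$ function on $\mathbb{CP}(1)$, and let $T_f^m=P^m\circ M_f\circ P^m:\Gamma_{hol}^m\to\Gamma_{hol}^m$, where $M_f$ is multiplication by $f$, be its Toeplitz quantization. Let $\lambda_0^m\ge\lambda_1^m\ge\cdots\ge\lambda_m^m$ be the eigenvalues of the Hermitian operator $T_f^m$, repeated according to multiplicity, and let $\Lambda^m$ be the step function on $[0,1)$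 with $\Lambda^m(s)=\lambda_k^m$ for $s\in\left[\frac{k}{m+1},\frac{k+1}{m+1}\right)$, $0\le k\le m$. Let $f^*(s)=\inf\{t\in\mathbb R:\ \mu(\{x: f(x)\ge t\})<s\}$ be the decreasing rearrangement of $f$. Then $\Lambda^m(s)\to f^*(s)$ as $m\to\infty$ for almost every $s\in[0,1)$. -/

import Mathlib

open MeasureTheory Filter Topology
open scoped ContDiff ComplexConjugate

noncomputable section

namespace ToeplitzCP1

/-! ### The Riemann sphere -/

/-- The complex projective line `CP(1)`: lines through the origin in `ℂ²`. -/
abbrev CP1 : Type := Projectivization ℂ (Fin 2 → ℂ)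

/-- The quotient topology of `ℂ² ∖ {0}`. -/
instance : TopologicalSpace CP1 :=
  inferInstanceAs (TopologicalSpace (Quotient (projectivizationSetoid ℂ (Fin 2 → ℂ))))

instance : MeasurableSpace CP1 := borel CP1

instance : BorelSpace CP1 := ⟨rfl⟩

/-- The affine coordinate `w ↦ [1, w]`. It misses only the point `[0, 1]`. -/
def chart₀ (w : ℂ) : CP1 :=
  Projectivization.mk ℂ ![1, w] (fun h => one_ne_zero (congrFun h 0))

/-- The affine coordinate `w ↦ [w, 1]`. It misses only the point `[1, 0]`. -/
def chart₁ (w : ℂ) : CP1 :=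
  Projectivization.mk ℂ ![w, 1] (fun h => one_ne_zero (congrFun h 1))

lemma continuous_chart₀ : Continuous chart₀ :=
  continuous_quotient_mk'.comp
    (Continuous.subtype_mk
      (by
        refine continuous_pi fun i => ?_
        fin_cases i
        · exact continuous_const
        · exact continuous_id)
      (fun w h => one_ne_zero (congrFun h 0)))

lemma measurable_chart₀ : Measurable chart₀ := continuous_chart₀.measurable

lemma chart₀_eq_chart₁ {w : ℂ} (hw : w ≠ 0) : chart₀ w = chart₁ w⁻¹ := by
  rw [chart₀, chart₁, Projectivization.mk_eq_mk_iff']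
  refine ⟨w, ?_⟩
  ext i
  fin_cases i <;> simp [hw]

/-- A real function on `CP(1)` is `C^∞` when it is so in both charts of the standard atlas. -/
def IsSmooth (f : CP1 → ℝ) : Prop :=
  ContDiff ℝ ∞ (fun w : ℂ => f (chart₀ w)) ∧ ContDiff ℝ ∞ (fun w : ℂ => f (chart₁ w))

lemma IsSmooth.exists_bound {f : CP1 → ℝ} (hf : IsSmooth f) :
    ∃ C : ℝ, ∀ w : ℂ, |f (chart₀ w)| ≤ C := by
  obtain ⟨C₀, h₀⟩ := (isCompact_closedBall (0 : ℂ) 1).exists_bound_of_continuousOn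
    hf.1.continuous.continuousOn
  obtain ⟨C₁, h₁⟩ := (isCompact_closedBall (0 : ℂ) 1).exists_bound_of_continuousOn
    hf.2.continuous.continuousOn
  refine ⟨max C₀ C₁, fun w => ?_⟩
  rcases le_total ‖w‖ 1 with h | h
  · exact (h₀ w (by simpa using h)).trans (le_max_left _ _)
  · have hw : w ≠ 0 := by
      rintro rfl
      simp at h
      linarith
    rw [chart₀_eq_chart₁ hw]
    refine (h₁ w⁻¹ ?_).trans (le_max_right _ _)
    simpa using inv_le_one_of_one_le₀ h

/-! ### The Fubini–Study measure -/

/-- The measure of `Ω = i (1 + w w̄)⁻² dw ∧ dw̄` in the coordinate `[1, w]`, where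
`i dw ∧ dw̄ = 2 dx ∧ dy` for `w = x + i y`. -/
def omegaChart : Measure ℂ :=
  volume.withDensity fun w => ENNReal.ofReal (2 / (1 + ‖w‖ ^ 2) ^ 2)

/-- The measure on `CP(1)` defined by the Fubini–Study form `Ω`; the point missed by the
coordinate `[1, w]` is a null set. -/
def omega : Measure CP1 := omegaChart.map chart₀

/-- The probability measure `(2π)⁻¹ Ω` on `CP(1)`. -/
def mu : Measure CP1 := ENNReal.ofReal (2 * Real.pi)⁻¹ • omega

/-! ### Decreasing rearrangement -/

/-- `F_g(t) = μ {g < t}`. -/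
def distributionFunction {X : Type*} [MeasurableSpace X] (μ : Measure X) (g : X → ℝ) (t : ℝ) : ℝ :=
  μ.real {x | g x < t}

/-- `g*(s) = inf {t ∈ ℝ : d_g(t) < s}` with `d_g(t) = μ(X) - F_g(t)`. -/
def decreasingRearrangement {X : Type*} [MeasurableSpace X] (μ : Measure X) (g : X → ℝ)
    (s : ℝ) : ℝ :=
  sInf {t : ℝ | μ.real Set.univ - distributionFunction μ g t < s}

/-! ### Sections of `L^{⊗m}` -/

/-- In the coordinate `[1, w]` a section of `L^{⊗m}` is a function of `w`, and its squared norm is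
`∫ ‖s(w)‖² (1 + |w|²)⁻ᵐ Ω`. This is the measure `(1 + |w|²)⁻ᵐ Ω`. -/
def sectionMeasure (m : ℕ) : Measure ℂ :=
  omegaChart.withDensity fun w => ENNReal.ofReal (1 / (1 + ‖w‖ ^ 2) ^ m)

/-- The Hilbert space `Γ₂ᵐ` of square-integrable sections of `L^{⊗m}`, with
`⟨s₁, s₂⟩ = ∫ s₁ s̄₂ (1 + |w|²)⁻ᵐ Ω` (Mathlib's `inner` is conjugate-linear in its first
argument). -/
abbrev SectionsL2 (m : ℕ) : Type := Lp ℂ 2 (sectionMeasure m)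

lemma sectionMeasure_eq (m : ℕ) : sectionMeasure m =
    volume.withDensity fun w : ℂ => ENNReal.ofReal (2 / (1 + ‖w‖ ^ 2) ^ (m + 2)) := by
  rw [sectionMeasure, omegaChart, ← withDensity_mul _ (by fun_prop) (by fun_prop)]
  congr 1
  ext w
  rw [Pi.mul_apply, ← ENNReal.ofReal_mul (by positivity)]
  congr 1
  field_simp
  ring

lemma integrable_base : Integrable (fun w : ℂ => 2 / (1 + ‖w‖ ^ 2) ^ 2) := by
  have h := (integrable_rpow_neg_one_add_norm_sq (E := ℂ) (μ := volume) (r := 4)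
    (by rw [Complex.finrank_real_complex]; norm_num)).const_mul 2
  refine h.congr (Eventually.of_forall fun w => ?_)
  have : (0 : ℝ) ≤ 1 + ‖w‖ ^ 2 := by positivity
  simp only
  rw [show (-4 / 2 : ℝ) = -(2 : ℕ) by norm_num, Real.rpow_neg this, Real.rpow_natCast]
  rfl

lemma memLp_pow {m k : ℕ} (hk : k ≤ m) : MemLp (fun w : ℂ => w ^ k) 2 (sectionMeasure m) := by
  rw [memLp_two_iff_integrable_sq_norm (by fun_prop), sectionMeasure_eq,
    integrable_withDensity_iff (by fun_prop) (by simp)]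
  refine integrable_base.mono' (by fun_prop) (Eventually.of_forall fun w => ?_)
  rw [ENNReal.toReal_ofReal (by positivity), norm_pow, Real.norm_of_nonneg (by positivity),
    ← pow_mul, mul_comm k 2, pow_mul]
  have h1 : (‖w‖ ^ 2) ^ k ≤ (1 + ‖w‖ ^ 2) ^ m :=
    (pow_le_pow_left₀ (by positivity) (by linarith) k).trans
      (pow_le_pow_right₀ (by nlinarith [sq_nonneg ‖w‖]) hk)
  rw [pow_add, mul_div_assoc', div_le_div_iff₀ (by positivity) (by positivity)]
  have h2 : 0 ≤ 2 * (1 + ‖w‖ ^ 2) ^ 2 := by positivity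
  nlinarith [mul_le_mul_of_nonneg_right h1 h2]

/-- The section of `L^{⊗m}` with local expression `w ^ k`. -/
def monomialSection (m : ℕ) (k : Fin (m + 1)) : SectionsL2 m :=
  (memLp_pow (Nat.lt_succ_iff.mp k.2)).toLp (fun w : ℂ => w ^ (k : ℕ))

/-- The space `Γ_holᵐ` of holomorphic sections of `L^{⊗m}`: the span of `1, w, …, wᵐ`. -/
def holomorphicSections (m : ℕ) : Submodule ℂ (SectionsL2 m) :=
  Submodule.span ℂ (Set.range (monomialSection m))

instance (m : ℕ) : FiniteDimensional ℂ (holomorphicSections m) :=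
  FiniteDimensional.span_of_finite ℂ (Set.finite_range _)

lemma linearIndependent_monomialSection (m : ℕ) : LinearIndependent ℂ (monomialSection m) := by
  rw [Fintype.linearIndependent_iff]
  intro c hc
  have hae : ∀ᵐ w ∂(sectionMeasure m), ∑ k : Fin (m + 1), c k * w ^ (k : ℕ) = 0 := by
    have h1 := Lp.coeFn_zero ℂ 2 (sectionMeasure m)
    rw [← hc] at h1
    have h2 : ∀ᵐ w ∂(sectionMeasure m), ∀ k : Fin (m + 1),
        (c k • monomialSection m k : SectionsL2 m) w = c k * w ^ (k : ℕ) := by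
      rw [ae_all_iff]
      intro k
      filter_upwards [Lp.coeFn_smul (c k) (monomialSection m k),
        (memLp_pow (Nat.lt_succ_iff.mp k.2)).coeFn_toLp] with w ha hb
      rw [ha, Pi.smul_apply, smul_eq_mul]
      congr 1
    filter_upwards [h1, h2,
      Lp.coeFn_finsetSum Finset.univ (fun k => c k • monomialSection m k)] with w ha hb hs
    rw [ha] at hs
    rw [Finset.sum_apply] at hs
    simpa [hb] using hs.symm
  have hvol : ∀ᵐ w : ℂ, ∑ k : Fin (m + 1), c k * w ^ (k : ℕ) = 0 := by
    rw [sectionMeasure_eq, ae_withDensity_iff (by fun_prop)] at hae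
    filter_upwards [hae] with w hw
    refine hw ?_
    simp only [ne_eq, ENNReal.ofReal_eq_zero, not_le]
    positivity
  have hzero : (fun w : ℂ => ∑ k : Fin (m + 1), c k * w ^ (k : ℕ)) = fun _ => 0 :=
    Continuous.ae_eq_iff_eq volume (by fun_prop) continuous_const |>.mp hvol
  have hp : (∑ k : Fin (m + 1), Polynomial.monomial (k : ℕ) (c k) : Polynomial ℂ) = 0 := by
    apply Polynomial.funext
    intro w
    simpa [Polynomial.eval_finsetSum] using congrFun hzero w
  intro k
  have := congrArg (fun p : Polynomial ℂ => p.coeff (k : ℕ)) hp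
  simpa [Polynomial.finsetSum_coeff, Polynomial.coeff_monomial, Fin.val_inj] using this

lemma finrank_holomorphicSections (m : ℕ) :
    Module.finrank ℂ (holomorphicSections m) = m + 1 := by
  rw [holomorphicSections, finrank_span_eq_card (linearIndependent_monomialSection m)]
  simp

/-! ### Toeplitz quantization -/

lemma IsSmooth.memLp_mul {f : CP1 → ℝ} (hf : IsSmooth f) {m : ℕ} (s : SectionsL2 m) :
    MemLp (fun w => (f (chart₀ w) : ℂ) * s w) 2 (sectionMeasure m) := by
  obtain ⟨C, hC⟩ := hf.exists_bound
  have hc : Continuous fun w => f (chart₀ w) := hf.1.continuous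
  refine (Lp.memLp s).of_le_mul (c := C)
    ((Complex.continuous_ofReal.comp hc).aestronglyMeasurable.mul (Lp.aestronglyMeasurable s))
    (Eventually.of_forall fun w => ?_)
  rw [norm_mul, Complex.norm_real]
  exact mul_le_mul_of_nonneg_right (hC w) (norm_nonneg _)

/-- The multiplication operator `M_f` on square-integrable sections. -/
def mulOperator {f : CP1 → ℝ} (hf : IsSmooth f) (m : ℕ) : SectionsL2 m →ₗ[ℂ] SectionsL2 m where
  toFun s := (hf.memLp_mul s).toLp (fun w => (f (chart₀ w) : ℂ) * s w)
  map_add' s t := by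
    rw [← MemLp.toLp_add, MemLp.toLp_eq_toLp_iff]
    filter_upwards [Lp.coeFn_add s t] with w hw
    simp only [Pi.add_apply] at hw ⊢
    rw [hw, mul_add]
  map_smul' c s := by
    rw [RingHom.id_apply, ← MemLp.toLp_const_smul, MemLp.toLp_eq_toLp_iff]
    filter_upwards [Lp.coeFn_smul c s] with w hw
    simp [hw, mul_left_comm]

/-- The Toeplitz quantization `T_fᵐ = Pᵐ ∘ M_f ∘ Pᵐ : Γ_holᵐ → Γ_holᵐ`, where `Pᵐ` is the orthogonal
projection of `Γ₂ᵐ` onto `Γ_holᵐ` (its restriction to `Γ_holᵐ` is the inclusion). -/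
def toeplitz {f : CP1 → ℝ} (hf : IsSmooth f) (m : ℕ) :
    holomorphicSections m →ₗ[ℂ] holomorphicSections m :=
  (holomorphicSections m).orthogonalProjectionOnto.toLinearMap ∘ₗ mulOperator hf m ∘ₗ
    (holomorphicSections m).subtype

lemma isSymmetric_mulOperator {f : CP1 → ℝ} (hf : IsSmooth f) (m : ℕ) :
    (mulOperator hf m).IsSymmetric := by
  intro s t
  rw [L2.inner_def, L2.inner_def]
  refine integral_congr_ae ?_
  filter_upwards [(hf.memLp_mul s).coeFn_toLp, (hf.memLp_mul t).coeFn_toLp] with w hs ht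
  change inner ℂ ((hf.memLp_mul s).toLp _ w) (t w) = inner ℂ (s w) ((hf.memLp_mul t).toLp _ w)
  rw [hs, ht]
  simp only [RCLike.inner_apply, map_mul, Complex.conj_ofReal]
  ring

lemma isSymmetric_toeplitz {f : CP1 → ℝ} (hf : IsSmooth f) (m : ℕ) :
    (toeplitz hf m).IsSymmetric := by
  intro s t
  have h := isSymmetric_mulOperator hf m (s : SectionsL2 m) (t : SectionsL2 m)
  simpa [toeplitz] using h

/-- The eigenvalues `λ₀ᵐ ≥ λ₁ᵐ ≥ ⋯ ≥ λ_mᵐ` of `T_fᵐ`, repeated according to multiplicity. -/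
def toeplitzEigenvalues {f : CP1 → ℝ} (hf : IsSmooth f) (m : ℕ) : Fin (m + 1) → ℝ :=
  (isSymmetric_toeplitz hf m).eigenvalues (finrank_holomorphicSections m)

/-- The step function `Λᵐ` equal to `λ_kᵐ` on `[k/(m+1), (k+1)/(m+1))` for `0 ≤ k ≤ m`. -/
def stepFunction {m : ℕ} (l : Fin (m + 1) → ℝ) (s : ℝ) : ℝ :=
  ∑ k : Fin (m + 1),
    (Set.Ico ((k : ℝ) / (m + 1)) (((k : ℝ) + 1) / (m + 1))).indicator (fun _ => l k) s

end ToeplitzCP1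

end

noncomputable section

namespace ToeplitzCP1

/-! ### Convergence of decreasing rearrangements -/

/-! The theorem reduces to one limit: for each `c`, the mean of `(λ_k - c)₊` over the spectrum tends
to `∫ (f - c)₊ dμ`. The convex functions `x ↦ (x - c)₊` suffice because their differences at two
values of `c`, divided by the gap, lie between indicators of half-lines. Eigenvalue counts are thus
trapped between superlevel measures of `f`, and `ae_tendsto_stepFunction` inverts this relation away
from countably many `s`.

The limit comes from the two Berezin–Lieb inequalities. Each eigenvalue is the mean of `f` against
the probability density of its eigensection, and these densities add up to the constant `m + 1`.
Jensen's inequality gives the upper bound `∫ (f - c)₊ dμ` for every `m`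
(`meanExcess_toeplitzEigenvalues_le`). Conversely, the Berezin transform of `f` at a point is the
mean of the eigenvalues with weights the densities there divided by `m + 1`. Jensen again bounds the
spectral mean below by the integral of `(· - c)₊` of the Berezin transform
(`integral_berezinTransform_le`). The Berezin kernel, explicit because the monomials are orthogonal
with norms given by inverse binomial coefficients, is an approximate identity. Dominated convergence
therefore makes the lower bound tend to the upper one. -/

lemma posPart_sub_le_of_lt {a b x : ℝ} (h : a < b) :
    max (x - a) 0 - max (x - b) 0 ≤ (b - a) * Set.indicator {y | a < y} (fun _ => 1) x := by
  by_cases hx : a < x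
  · rw [Set.indicator_of_mem (by exact hx)]
    rcases max_cases (x - a) 0 with h1 | h1 <;> rcases max_cases (x - b) 0 with h2 | h2 <;> linarith
  · rw [Set.indicator_of_notMem (by exact hx)]
    rcases max_cases (x - a) 0 with h1 | h1 <;> rcases max_cases (x - b) 0 with h2 | h2 <;> linarith

lemma le_posPart_sub_of_lt {a b x : ℝ} (h : a < b) :
    (b - a) * Set.indicator {y | b ≤ y} (fun _ => 1) x ≤ max (x - a) 0 - max (x - b) 0 := by
  by_cases hx : b ≤ x
  · rw [Set.indicator_of_mem (by exact hx)]
    rcases max_cases (x - a) 0 with h1 | h1 <;> rcases max_cases (x - b) 0 with h2 | h2 <;> linarith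
  · rw [Set.indicator_of_notMem (by exact hx)]
    rcases max_cases (x - a) 0 with h1 | h1 <;> rcases max_cases (x - b) 0 with h2 | h2 <;> linarith

/-- The mean of `(l_k - c)₊`. -/
def meanExcess {m : ℕ} (l : Fin (m + 1) → ℝ) (c : ℝ) : ℝ :=
  (∑ k, max (l k - c) 0) / (m + 1)

lemma meanExcess_sub_le {m : ℕ} (l : Fin (m + 1) → ℝ) {a b : ℝ} (h : a < b) :
    meanExcess l a - meanExcess l b ≤
      (b - a) * (((Finset.univ.filter fun k => a < l k).card : ℝ) / (m + 1)) := by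
  rw [meanExcess, meanExcess, ← sub_div, ← Finset.sum_sub_distrib, ← mul_div_assoc]
  gcongr
  refine (Finset.sum_le_sum fun k _ => posPart_sub_le_of_lt h).trans_eq ?_
  rw [← Finset.mul_sum, Finset.card_filter]
  simp [Set.indicator_apply]

lemma le_meanExcess_sub {m : ℕ} (l : Fin (m + 1) → ℝ) {a b : ℝ} (h : a < b) :
    (b - a) * (((Finset.univ.filter fun k => b ≤ l k).card : ℝ) / (m + 1)) ≤
      meanExcess l a - meanExcess l b := by
  rw [meanExcess, meanExcess, ← sub_div, ← Finset.sum_sub_distrib, ← mul_div_assoc]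
  gcongr
  refine Eq.trans_le ?_ (Finset.sum_le_sum fun k _ => le_posPart_sub_of_lt h)
  rw [← Finset.mul_sum, Finset.card_filter]
  simp [Set.indicator_apply]

lemma exists_stepFunction_eq {m : ℕ} (l : Fin (m + 1) → ℝ) {s : ℝ} (hs : s ∈ Set.Ico (0 : ℝ) 1) :
    ∃ k : Fin (m + 1), (k : ℝ) / (m + 1) ≤ s ∧ s < ((k : ℝ) + 1) / (m + 1) ∧
      stepFunction l s = l k := by
  have hm : (0 : ℝ) < m + 1 := by positivity
  have h0 : 0 ≤ s * (m + 1) := mul_nonneg hs.1 hm.le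
  have hlt : ⌊s * (m + 1)⌋₊ < m + 1 := by
    rw [Nat.floor_lt h0]
    push_cast
    nlinarith [hs.2]
  have h1 : ((⌊s * (m + 1)⌋₊ : ℕ) : ℝ) / (m + 1) ≤ s := by
    rw [div_le_iff₀ hm]
    exact Nat.floor_le h0
  have h2 : s < ((⌊s * (m + 1)⌋₊ : ℕ) + 1 : ℝ) / (m + 1) := by
    rw [lt_div_iff₀ hm]
    exact Nat.lt_floor_add_one _
  refine ⟨⟨_, hlt⟩, h1, h2, ?_⟩
  rw [stepFunction, Finset.sum_eq_single ⟨_, hlt⟩]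
  · exact Set.indicator_of_mem (Set.mem_Ico.2 ⟨h1, h2⟩) _
  · intro j _ hj
    refine Set.indicator_of_notMem (fun hmem => hj ?_) _
    rw [Set.mem_Ico, div_le_iff₀ hm, lt_div_iff₀ hm] at hmem
    ext
    exact ((Nat.floor_eq_iff h0).2 hmem).symm
  · simp

/-- If the value at the step `k` containing `s` were at least `t`, so would be the first `k + 1`
values, and their proportion exceeds `s`. -/
lemma stepFunction_lt {m : ℕ} {l : Fin (m + 1) → ℝ} (hl : Antitone l) {s t : ℝ}
    (hs : s ∈ Set.Ico (0 : ℝ) 1)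
    (h : ((Finset.univ.filter fun k => t ≤ l k).card : ℝ) / (m + 1) < s) :
    stepFunction l s < t := by
  obtain ⟨k, -, hk, he⟩ := exists_stepFunction_eq l hs
  rw [he]
  by_contra! hlt
  have hsub : Finset.Iic k ⊆ Finset.univ.filter fun k => t ≤ l k := fun j hj => by
    simpa using hlt.trans (hl (Finset.mem_Iic.1 hj))
  have hc := Finset.card_le_card hsub
  rw [Fin.card_Iic] at hc
  have : ((k : ℝ) + 1) ≤ ((Finset.univ.filter fun k => t ≤ l k).card : ℝ) := by exact_mod_cast hc
  have := div_le_div_of_nonneg_right this (show (0 : ℝ) ≤ m + 1 by positivity)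
  linarith

lemma lt_stepFunction {m : ℕ} {l : Fin (m + 1) → ℝ} (hl : Antitone l) {s t : ℝ}
    (hs : s ∈ Set.Ico (0 : ℝ) 1)
    (h : s < ((Finset.univ.filter fun k => t < l k).card : ℝ) / (m + 1)) :
    t < stepFunction l s := by
  obtain ⟨k, hk, -, he⟩ := exists_stepFunction_eq l hs
  rw [he]
  by_contra! hlt
  have hsub : (Finset.univ.filter fun k => t < l k) ⊆ Finset.Iio k := fun j hj => by
    rw [Finset.mem_Iio]
    by_contra! hkj
    exact absurd ((Finset.mem_filter.1 hj).2) (not_lt.2 ((hl hkj).trans hlt))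
  have hc := Finset.card_le_card hsub
  rw [Fin.card_Iio] at hc
  have : ((Finset.univ.filter fun k => t < l k).card : ℝ) ≤ (k : ℝ) := by exact_mod_cast hc
  have := div_le_div_of_nonneg_right this (show (0 : ℝ) ≤ m + 1 by positivity)
  linarith

section Rearrangement

variable {X : Type*} [MeasurableSpace X] {μ : Measure X} [IsProbabilityMeasure μ] {g : X → ℝ}

lemma integrable_posPart_sub (hi : Integrable g μ) (c : ℝ) :
    Integrable (fun x => max (g x - c) 0) μ :=
  (hi.sub (integrable_const c)).pos_part

/-- The strict superlevel set is enlarged to the closed one, the set that enters the rearrangement.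
-/
lemma integral_posPart_sub_le (hg : Measurable g) (hi : Integrable g μ) {a b : ℝ} (h : a < b) :
    ∫ x, max (g x - a) 0 ∂μ - ∫ x, max (g x - b) 0 ∂μ ≤ (b - a) * μ.real {x | a ≤ g x} := by
  have hm : MeasurableSet {x | a ≤ g x} := measurableSet_le measurable_const hg
  rw [← integral_sub (integrable_posPart_sub hi a) (integrable_posPart_sub hi b),
    ← integral_indicator_one hm, ← integral_const_mul]
  refine integral_mono ((integrable_posPart_sub hi a).sub (integrable_posPart_sub hi b))
    (((integrable_const (1 : ℝ)).indicator hm).const_mul _) fun x => ?_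
  refine (posPart_sub_le_of_lt h).trans (mul_le_mul_of_nonneg_left ?_ (by linarith))
  simp only [Set.indicator_apply, Set.mem_ofPred_eq, Pi.one_apply]
  split_ifs <;> first | exact le_rfl | exact zero_le_one | (exfalso; linarith)

lemma le_integral_posPart_sub (hg : Measurable g) (hi : Integrable g μ) {a b : ℝ} (h : a < b) :
    (b - a) * μ.real {x | b ≤ g x} ≤ ∫ x, max (g x - a) 0 ∂μ - ∫ x, max (g x - b) 0 ∂μ := by
  have hm : MeasurableSet {x | b ≤ g x} := measurableSet_le measurable_const hg
  rw [← integral_sub (integrable_posPart_sub hi a) (integrable_posPart_sub hi b),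
    ← integral_indicator_one hm, ← integral_const_mul]
  exact integral_mono (((integrable_const (1 : ℝ)).indicator hm).const_mul _)
    ((integrable_posPart_sub hi a).sub (integrable_posPart_sub hi b))
    fun x => le_posPart_sub_of_lt h

lemma decreasingRearrangement_eq (hg : Measurable g) (s : ℝ) :
    decreasingRearrangement μ g s = sInf {t : ℝ | μ.real {x | t ≤ g x} < s} := by
  have h : ∀ t, μ.real Set.univ - distributionFunction μ g t = μ.real {x | t ≤ g x} := fun t => by
    rw [distributionFunction, ← measureReal_compl (measurableSet_lt hg measurable_const)]
    congr 1
    ext x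
    simp
  simp only [decreasingRearrangement, h]

lemma antitone_measureReal_superlevel : Antitone fun t : ℝ => μ.real {x | t ≤ g x} :=
  fun _ _ h => measureReal_mono fun _ hx => h.trans hx

/-- If the mean excesses of decreasing finite sequences converge to those of a bounded function,
then the associated step functions converge almost everywhere to its decreasing rearrangement. -/
theorem ae_tendsto_stepFunction (hg : Measurable g) {C : ℝ} (hC : ∀ x, |g x| ≤ C)
    {l : (m : ℕ) → Fin (m + 1) → ℝ} (hl : ∀ m, Antitone (l m))
    (h : ∀ c, Tendsto (fun m => meanExcess (l m) c) atTop (𝓝 (∫ x, max (g x - c) 0 ∂μ))) :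
    ∀ᵐ s : ℝ ∂(volume.restrict (Set.Ico (0 : ℝ) 1)),
      Tendsto (fun m => stepFunction (l m) s) atTop (𝓝 (decreasingRearrangement μ g s)) := by
  set d : ℝ → ℝ := fun t => μ.real {x | t ≤ g x} with hd
  have hanti : Antitone d := antitone_measureReal_superlevel
  have hi : Integrable g μ :=
    Integrable.of_bound hg.aestronglyMeasurable C (Eventually.of_forall hC)
  -- The exceptional `s`: at `0` the set defining the infimum is empty, and a value `d r` could be
  -- attained on a whole interval, where `d b > s` may fail below the infimum.
  have hcount : (insert 0 (Set.range fun r : ℚ => d r)).Countable :=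
    (Set.countable_range _).insert 0
  filter_upwards [ae_restrict_mem measurableSet_Ico,
    ae_restrict_of_ae (hcount.ae_notMem volume)] with s hs hns
  rw [Set.mem_insert_iff, not_or] at hns
  have hs0 : 0 < s := lt_of_le_of_ne hs.1 (Ne.symm hns.1)
  have hne : {t : ℝ | d t < s}.Nonempty := by
    refine ⟨C + 1, ?_⟩
    have : {x | C + 1 ≤ g x} = ∅ := by
      ext x
      have := (abs_le.1 (hC x)).2
      simp only [Set.mem_ofPred_eq, Set.mem_empty_iff_false, iff_false, not_le]
      linarith
    simp [hd, this, hs0]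
  have hbdd : BddBelow {t : ℝ | d t < s} := by
    refine ⟨-C, fun t ht => ?_⟩
    by_contra! hlt
    have : {x | t ≤ g x} = Set.univ := by
      ext x
      have := (abs_le.1 (hC x)).1
      simp only [Set.mem_ofPred_eq, Set.mem_univ, iff_true]
      linarith
    simp only [hd, Set.mem_ofPred_eq, this, probReal_univ] at ht
    linarith [hs.2]
  rw [decreasingRearrangement_eq hg, tendsto_order]
  refine ⟨fun t ht => ?_, fun t ht => ?_⟩
  · obtain ⟨b, htb, hb⟩ := exists_between ht
    have hdb : s < d b := by
      -- Below the infimum only `s ≤ d r` is automatic; rationality of `r` makes it strict by the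
      -- choice of `s`.
      obtain ⟨r, hbr, hr⟩ := exists_rat_btwn hb
      have h1 : s ≤ d r := by
        by_contra! hlt
        exact absurd (csInf_le hbdd hlt) (not_le.2 hr)
      exact (lt_of_le_of_ne h1 fun he => hns.2 ⟨r, he.symm⟩).trans_le (hanti hbr.le)
    have hlim := (h t).sub (h b)
    have hbt : 0 < b - t := by linarith
    have hev := hlim.eventually_const_lt
      ((mul_lt_mul_of_pos_left hdb hbt).trans_le (le_integral_posPart_sub hg hi htb))
    filter_upwards [hev] with m hm
    exact lt_stepFunction (hl m) hs
      (lt_of_mul_lt_mul_left (hm.trans_le (meanExcess_sub_le _ htb)) hbt.le)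
  · obtain ⟨a, ha, hat⟩ := exists_between ht
    have hda : d a < s := by
      obtain ⟨a', ha', hlt⟩ := exists_lt_of_csInf_lt hne ha
      exact (hanti hlt.le).trans_lt ha'
    have hlim := (h a).sub (h t)
    have hta : 0 < t - a := by linarith
    have hev := hlim.eventually_lt_const
      ((integral_posPart_sub_le hg hi hat).trans_lt (mul_lt_mul_of_pos_left hda hta))
    filter_upwards [hev] with m hm
    exact stepFunction_lt (hl m) hs
      (lt_of_mul_lt_mul_left ((le_meanExcess_sub _ hat).trans_lt hm) hta.le)

end Rearrangement

/-! ### Inner products of monomials -/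

lemma integral_pow_mul_one_sub_pow (a b : ℕ) :
    ∫ t in (0 : ℝ)..1, t ^ a * (1 - t) ^ b =
      (a.factorial * b.factorial : ℝ) / (a + b + 1).factorial := by
  have h := Complex.Gamma_mul_Gamma_eq_betaIntegral (s := (a : ℂ) + 1) (t := (b : ℂ) + 1)
    (by simp; positivity) (by simp; positivity)
  rw [show (a : ℂ) + 1 + (b + 1) = ((a + b + 1 : ℕ) : ℂ) + 1 by push_cast; ring,
    Complex.Gamma_nat_eq_factorial, Complex.Gamma_nat_eq_factorial,
    Complex.Gamma_nat_eq_factorial, Complex.betaIntegral] at h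
  have h2 : ∫ x in (0 : ℝ)..1, (x : ℂ) ^ ((a : ℂ) + 1 - 1) * (1 - (x : ℂ)) ^ ((b : ℂ) + 1 - 1) =
      ((∫ t in (0 : ℝ)..1, t ^ a * (1 - t) ^ b : ℝ) : ℂ) := by
    rw [← intervalIntegral.integral_ofReal]
    simp
  rw [h2] at h
  have hne : ((a + b + 1).factorial : ℝ) ≠ 0 := by positivity
  rw [eq_div_iff hne]
  have h3 : (a.factorial * b.factorial : ℝ) = (a + b + 1).factorial *
      ∫ t in (0 : ℝ)..1, t ^ a * (1 - t) ^ b := by exact_mod_cast h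
  rw [h3, mul_comm]

/-- The substitution `t = y² / (1 + y²)` turns this radial integral, with the polar factor `y`, into
a Beta integral; `G` is the primitive of the latter. -/
lemma integral_Ioi_pow_div_pow {m k : ℕ} (hk : k ≤ m) :
    ∫ y in Set.Ioi (0 : ℝ), y * (y ^ (2 * k) * (2 / (1 + y ^ 2) ^ (m + 2))) =
      (k.factorial * (m - k).factorial : ℝ) / (m + 1).factorial := by
  set G : ℝ → ℝ := fun x => ∫ t in (0 : ℝ)..x, t ^ k * (1 - t) ^ (m - k) with hG
  have hcont : Continuous fun t : ℝ => t ^ k * (1 - t) ^ (m - k) := by fun_prop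
  have hd : ∀ y : ℝ, HasDerivAt (fun y : ℝ => G (1 - (1 + y ^ 2)⁻¹))
      (y * (y ^ (2 * k) * (2 / (1 + y ^ 2) ^ (m + 2)))) y := by
    intro y
    have hp : (1 + y ^ 2) ≠ 0 := by positivity
    have h1 : HasDerivAt (fun y : ℝ => 1 - (1 + y ^ 2)⁻¹) (2 * y / (1 + y ^ 2) ^ 2) y := by
      have := (((hasDerivAt_pow 2 y).const_add 1).inv hp).const_sub 1
      refine this.congr_deriv ?_
      push_cast
      ring
    have h2 := (hcont.integral_hasStrictDerivAt 0 (1 - (1 + y ^ 2)⁻¹)).hasDerivAt.comp y h1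
    refine h2.congr_deriv ?_
    have hm2 : m + 2 = k + (m - k) + 2 := by omega
    rw [hm2, show (1 : ℝ) - (1 - (1 + y ^ 2)⁻¹) = (1 + y ^ 2)⁻¹ by ring,
      show 1 - (1 + y ^ 2)⁻¹ = y ^ 2 / (1 + y ^ 2) by field_simp; ring]
    simp only [div_pow, inv_pow, pow_add, pow_mul]
    field_simp
  have hlim : Tendsto (fun y : ℝ => G (1 - (1 + y ^ 2)⁻¹)) atTop (𝓝 (G 1)) := by
    have hGc : Continuous G := intervalIntegral.continuous_primitive
      (fun a b => hcont.intervalIntegrable a b) 0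
    refine (hGc.tendsto 1).comp ?_
    have : Tendsto (fun y : ℝ => (1 + y ^ 2)⁻¹) atTop (𝓝 0) :=
      tendsto_inv_atTop_zero.comp (tendsto_atTop_add_const_left _ _ (tendsto_pow_atTop two_ne_zero))
    simpa using this.const_sub 1
  rw [integral_Ioi_of_hasDerivAt_of_nonneg' (fun y _ => hd y)
    (fun y hy => by have : (0 : ℝ) < y := hy; positivity) hlim]
  simp only [hG]
  rw [integral_pow_mul_one_sub_pow]
  simp [Nat.add_sub_cancel' hk]

lemma integral_norm_pow_mul {m k : ℕ} (hk : k ≤ m) :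
    ∫ w : ℂ, ‖w‖ ^ (2 * k) * (2 / (1 + ‖w‖ ^ 2) ^ (m + 2)) =
      2 * Real.pi * ((k.factorial * (m - k).factorial : ℝ) / (m + 1).factorial) := by
  rw [integral_fun_norm_addHaar volume fun y : ℝ => y ^ (2 * k) * (2 / (1 + y ^ 2) ^ (m + 2)),
    Complex.finrank_real_complex]
  simp only [Nat.add_one_sub_one, pow_one, smul_eq_mul]
  rw [integral_Ioi_pow_div_pow hk]
  simp [Measure.real, Complex.volume_ball]
  ring

lemma integral_sectionMeasure {E : Type*} [NormedAddCommGroup E] [NormedSpace ℝ E] (m : ℕ)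
    (h : ℂ → E) :
    ∫ w, h w ∂(sectionMeasure m) = ∫ w, (2 / (1 + ‖w‖ ^ 2) ^ (m + 2) : ℝ) • h w := by
  rw [sectionMeasure_eq, integral_withDensity_eq_integral_toReal_smul (by fun_prop) (by simp)]
  refine integral_congr_ae (Eventually.of_forall fun w => ?_)
  simp only
  rw [ENNReal.toReal_ofReal (by positivity)]

/-- Rotation by `u` preserves Lebesgue measure and multiplies the integrand by `u ^ (k - j)`, so the
integral vanishes once this factor is not `1`. -/
lemma integral_rotation_eq_zero {j k : ℕ} (hjk : j ≠ k) (ρ : ℝ → ℝ) :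
    ∫ w : ℂ, ρ ‖w‖ • (conj (w ^ j) * w ^ k) = 0 := by
  have hne : (k : ℝ) - j ≠ 0 := sub_ne_zero.2 (Nat.cast_injective.ne hjk.symm)
  obtain ⟨u, hu⟩ : ∃ u : Circle, conj ((u : ℂ) ^ j) * (u : ℂ) ^ k ≠ 1 := by
    -- With this angle the factor is `-1`; if it were `1`, then `2n = -1` for some integer `n`.
    refine ⟨Circle.exp (Real.pi / ((k : ℝ) - j)), fun h => ?_⟩
    rw [map_pow, ← Circle.coe_inv_eq_conj, ← Circle.coe_pow, ← Circle.coe_pow, ← Circle.coe_mul,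
      Circle.coe_eq_one, inv_pow, inv_mul_eq_one, ← Circle.exp_nsmul, ← Circle.exp_nsmul] at h
    obtain ⟨n, hn⟩ := Circle.exp_eq_exp.1 h
    simp only [nsmul_eq_mul] at hn
    have h1 : (j : ℝ) * (Real.pi / (k - j)) - k * (Real.pi / (k - j)) = -Real.pi := by
      field_simp
      ring
    have h2 : (2 * n : ℝ) = -1 := by
      refine mul_right_cancel₀ Real.pi_ne_zero ?_
      linear_combination h1 - hn
    have h3 : 2 * n = -1 := by exact_mod_cast h2
    omega
  have hr := (rotation u).measurePreserving.integral_comp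
    (rotation u).toHomeomorph.measurableEmbedding (fun w : ℂ => ρ ‖w‖ • (conj (w ^ j) * w ^ k))
  have h2 : ∀ w : ℂ, ρ ‖rotation u w‖ • (conj ((rotation u w) ^ j) * (rotation u w) ^ k) =
      (conj ((u : ℂ) ^ j) * (u : ℂ) ^ k) * (ρ ‖w‖ • (conj (w ^ j) * w ^ k)) := by
    intro w
    rw [LinearIsometryEquiv.norm_map, rotation_apply]
    simp only [mul_pow, map_mul, Complex.real_smul]
    ring
  simp only [h2] at hr
  rw [integral_const_mul] at hr
  by_contra hne
  exact hu (mul_right_cancel₀ hne (hr.trans (one_mul _).symm))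

/-- The squared norm of the section `w ^ k`. -/
def monomialNormSq (m k : ℕ) : ℝ :=
  2 * Real.pi * ((k.factorial * (m - k).factorial : ℝ) / (m + 1).factorial)

lemma monomialNormSq_pos (m k : ℕ) : 0 < monomialNormSq m k := by
  rw [monomialNormSq]
  have := Real.pi_pos
  positivity

lemma inner_monomialSection (m : ℕ) (j k : Fin (m + 1)) :
    inner ℂ (monomialSection m j) (monomialSection m k) =
      if j = k then (monomialNormSq m k : ℂ) else 0 := by
  have h1 : inner ℂ (monomialSection m j) (monomialSection m k) =
      ∫ w, conj (w ^ (j : ℕ)) * w ^ (k : ℕ) ∂(sectionMeasure m) := by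
    rw [L2.inner_def]
    refine integral_congr_ae ?_
    filter_upwards [(memLp_pow (Nat.lt_succ_iff.mp j.2)).coeFn_toLp,
      (memLp_pow (Nat.lt_succ_iff.mp k.2)).coeFn_toLp] with w hj hk
    rw [monomialSection, monomialSection, hj, hk, RCLike.inner_apply, mul_comm]
  rw [h1, integral_sectionMeasure]
  split_ifs with h
  · subst h
    rw [monomialNormSq, ← integral_norm_pow_mul (Nat.lt_succ_iff.mp j.2), ← integral_complex_ofReal]
    refine integral_congr_ae (Eventually.of_forall fun w => ?_)
    simp only [Complex.real_smul]
    rw [mul_comm (conj _), Complex.mul_conj, Complex.normSq_eq_norm_sq, norm_pow, ← pow_mul,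
      mul_comm (j : ℕ) 2, ← Complex.ofReal_mul, mul_comm]
  · exact integral_rotation_eq_zero (fun he => h (Fin.ext he))
      fun r => 2 / (1 + r ^ 2) ^ (m + 2)

/-! ### Evaluation of holomorphic sections and the reproducing kernel -/

/-- The sections `1, w, …, wᵐ` as a basis of the space of holomorphic sections. -/
def monomialBasis (m : ℕ) : Module.Basis (Fin (m + 1)) ℂ (holomorphicSections m) :=
  Module.Basis.span (linearIndependent_monomialSection m)

lemma coe_monomialBasis (m : ℕ) (k : Fin (m + 1)) :
    (monomialBasis m k : SectionsL2 m) = monomialSection m k :=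
  congrArg Subtype.val (Module.Basis.span_apply (linearIndependent_monomialSection m) k)

/-- The value of (the polynomial representing) a holomorphic section at `w`. -/
def evalSection (m : ℕ) (w : ℂ) : holomorphicSections m →ₗ[ℂ] ℂ :=
  (monomialBasis m).constr ℂ fun k => w ^ (k : ℕ)

lemma evalSection_apply (m : ℕ) (w : ℂ) (v : holomorphicSections m) :
    evalSection m w v = ∑ k, (monomialBasis m).repr v k * w ^ (k : ℕ) := by
  simp [evalSection, Module.Basis.constr_apply_fintype]

lemma evalSection_monomialBasis (m : ℕ) (w : ℂ) (k : Fin (m + 1)) :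
    evalSection m w (monomialBasis m k) = w ^ (k : ℕ) := by
  rw [evalSection, Module.Basis.constr_basis]

lemma continuous_evalSection {m : ℕ} (v : holomorphicSections m) :
    Continuous fun w => evalSection m w v := by
  simp only [evalSection_apply]
  fun_prop

/-- Elements of `L²` have no point values; this lets the polynomial representative stand in for the
class under integrals. -/
lemma coeFn_eq_evalSection {m : ℕ} (v : holomorphicSections m) :
    ((v : SectionsL2 m) : ℂ → ℂ) =ᵐ[sectionMeasure m] fun w => evalSection m w v := by
  have hv : (v : SectionsL2 m) = ∑ k, (monomialBasis m).repr v k • monomialSection m k := by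
    conv_lhs => rw [← (monomialBasis m).sum_repr v]
    rw [Submodule.coe_sum]
    simp only [Submodule.coe_smul, coe_monomialBasis]
  have h2 : ∀ᵐ w ∂(sectionMeasure m), ∀ k : Fin (m + 1),
      ((monomialBasis m).repr v k • monomialSection m k : SectionsL2 m) w =
        (monomialBasis m).repr v k * w ^ (k : ℕ) := by
    rw [ae_all_iff]
    intro k
    filter_upwards [Lp.coeFn_smul ((monomialBasis m).repr v k) (monomialSection m k),
      (memLp_pow (Nat.lt_succ_iff.mp k.2)).coeFn_toLp] with w ha hb
    rw [ha, Pi.smul_apply, smul_eq_mul]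
    congr 1
  rw [hv]
  filter_upwards [h2, Lp.coeFn_finsetSum Finset.univ
    (fun k => (monomialBasis m).repr v k • monomialSection m k)] with w hb hs
  rw [hs, Finset.sum_apply, evalSection_apply]
  exact Finset.sum_congr rfl fun k _ => hb k

/-- The section representing evaluation at `w`. -/
def kernelSection (m : ℕ) (w : ℂ) : holomorphicSections m :=
  ∑ k : Fin (m + 1), (conj (w ^ (k : ℕ)) / monomialNormSq m k) • monomialBasis m k

/-- By linearity it is enough to test monomials, where orthogonality leaves one term; the conjugates
in the kernel undo the conjugate-linearity of the first slot. -/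
lemma inner_kernelSection {m : ℕ} (w : ℂ) (v : holomorphicSections m) :
    inner ℂ (kernelSection m w) v = evalSection m w v := by
  have h : innerₛₗ ℂ (kernelSection m w) = evalSection m w := by
    refine (monomialBasis m).ext fun k => ?_
    rw [evalSection_monomialBasis, innerₛₗ_apply_apply, kernelSection, sum_inner,
      Finset.sum_eq_single k]
    · rw [inner_smul_left (x := monomialBasis m k), Submodule.coe_inner, coe_monomialBasis,
        inner_monomialSection, if_pos rfl,
        map_div₀, Complex.conj_conj, Complex.conj_ofReal, div_mul_cancel₀]
      exact_mod_cast (monomialNormSq_pos m k).ne'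
    · intro j _ hj
      rw [inner_smul_left (x := monomialBasis m j), Submodule.coe_inner, coe_monomialBasis,
        coe_monomialBasis,
        inner_monomialSection, if_neg hj, mul_zero]
    · simp
  exact LinearMap.congr_fun h v

lemma inv_monomialNormSq {m k : ℕ} (hk : k ≤ m) :
    (monomialNormSq m k)⁻¹ = (m + 1) / (2 * Real.pi) * m.choose k := by
  have hpi := Real.pi_pos.ne'
  rw [monomialNormSq, Nat.cast_choose ℝ hk, Nat.factorial_succ]
  push_cast
  field_simp

/-- The inverse squared norms are binomial coefficients up to a common factor, so the binomial
theorem sums the kernel. -/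
lemma evalSection_kernelSection (m : ℕ) (z w : ℂ) :
    evalSection m z (kernelSection m w) = (m + 1) / (2 * Real.pi) * (1 + conj w * z) ^ m := by
  rw [kernelSection, map_sum, add_comm 1, add_pow, Finset.sum_range, Finset.mul_sum]
  refine Finset.sum_congr rfl fun k _ => ?_
  have h : ((monomialNormSq m k : ℝ) : ℂ)⁻¹ = (m + 1) / (2 * Real.pi) * m.choose k := by
    exact_mod_cast congrArg Complex.ofReal (inv_monomialNormSq (Nat.lt_succ_iff.mp k.2))
  rw [map_smul, evalSection_monomialBasis, div_eq_mul_inv, h, smul_eq_mul, map_pow, mul_pow]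
  ring

lemma norm_kernelSection_sq (m : ℕ) (w : ℂ) :
    ‖kernelSection m w‖ ^ 2 = (m + 1) / (2 * Real.pi) * (1 + ‖w‖ ^ 2) ^ m := by
  have h := inner_self_eq_norm_sq_to_K (𝕜 := ℂ) (kernelSection m w)
  rw [inner_kernelSection, evalSection_kernelSection, mul_comm (conj w), Complex.mul_conj,
    Complex.normSq_eq_norm_sq] at h
  refine Complex.ofReal_injective ?_
  push_cast at h ⊢
  exact h.symm

/-! ### The normalized Fubini–Study measure in the affine coordinate -/

/-- The probability measure `(2π)⁻¹ Ω` in the coordinate `[1, w]`. -/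
def muChart : Measure ℂ := ENNReal.ofReal (2 * Real.pi)⁻¹ • omegaChart

lemma mu_eq_map : mu = muChart.map chart₀ := by
  rw [mu, muChart, omega, Measure.map_smul]

lemma omegaChart_eq : omegaChart = ENNReal.ofReal (2 * Real.pi) • muChart := by
  have := Real.pi_pos
  rw [muChart, smul_smul, ← ENNReal.ofReal_mul (by positivity), mul_inv_cancel₀ (by positivity),
    ENNReal.ofReal_one, one_smul]

instance : IsProbabilityMeasure muChart := by
  have hpi := Real.pi_pos
  refine ⟨?_⟩
  -- The total mass of `Ω` is the squared norm of the constant section for `m = 0`.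
  have h := integral_norm_pow_mul (m := 0) (k := 0) le_rfl
  simp only [mul_zero, pow_zero, one_mul, zero_add, Nat.factorial_zero, Nat.sub_self,
    Nat.factorial_one, Nat.cast_one, mul_one, div_one] at h
  rw [muChart, Measure.smul_apply, omegaChart, withDensity_apply _ MeasurableSet.univ,
    Measure.restrict_univ, ← ofReal_integral_eq_lintegral_ofReal integrable_base
      (Eventually.of_forall fun w => by positivity), h, smul_eq_mul,
    ← ENNReal.ofReal_mul (by positivity), inv_mul_cancel₀ (by positivity), ENNReal.ofReal_one]

instance : IsProbabilityMeasure mu := by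
  rw [mu_eq_map]
  exact Measure.isProbabilityMeasure_map measurable_chart₀.aemeasurable

lemma integral_sectionMeasure_eq_muChart (m : ℕ) (h : ℂ → ℝ) :
    ∫ w, h w ∂(sectionMeasure m) = ∫ w, h w * (2 * Real.pi / (1 + ‖w‖ ^ 2) ^ m) ∂muChart := by
  have hpi := Real.pi_pos
  rw [sectionMeasure, integral_withDensity_eq_integral_toReal_smul (by fun_prop) (by simp),
    omegaChart_eq, integral_smul_measure, ENNReal.toReal_ofReal (by positivity), ← integral_smul]
  refine integral_congr_ae (Eventually.of_forall fun w => ?_)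
  simp only [smul_eq_mul]
  rw [ENNReal.toReal_ofReal (by positivity)]
  ring

/-! ### Densities of holomorphic sections -/

/-- The density of the squared norm of a holomorphic section with respect to `(2π)⁻¹ Ω`. -/
def sectionDensity {m : ℕ} (v : holomorphicSections m) (w : ℂ) : ℝ :=
  ‖evalSection m w v‖ ^ 2 * (2 * Real.pi / (1 + ‖w‖ ^ 2) ^ m)

lemma sectionDensity_nonneg {m : ℕ} (v : holomorphicSections m) (w : ℂ) :
    0 ≤ sectionDensity v w := by
  have := Real.pi_pos
  rw [sectionDensity]
  positivity

lemma continuous_sectionDensity {m : ℕ} (v : holomorphicSections m) :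
    Continuous (sectionDensity v) := by
  refine ((continuous_evalSection v).norm.pow 2).mul (continuous_const.div (by fun_prop) fun w => ?_)
  positivity

/-- Cauchy–Schwarz against the reproducing kernel, whose norm cancels the weight. -/
lemma sectionDensity_le {m : ℕ} (v : holomorphicSections m) (w : ℂ) :
    sectionDensity v w ≤ (m + 1) * ‖v‖ ^ 2 := by
  have hpi := Real.pi_pos
  have h1 : ‖evalSection m w v‖ ^ 2 ≤ ‖kernelSection m w‖ ^ 2 * ‖v‖ ^ 2 := by
    rw [← inner_kernelSection, ← mul_pow]
    exact pow_le_pow_left₀ (norm_nonneg _) (norm_inner_le_norm (𝕜 := ℂ) (kernelSection m w) v) 2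
  rw [norm_kernelSection_sq] at h1
  refine (mul_le_mul_of_nonneg_right h1 (by positivity)).trans_eq ?_
  field_simp

lemma integrable_mul_sectionDensity {m : ℕ} (v : holomorphicSections m) {g : ℂ → ℝ}
    (hg : Continuous g) {C : ℝ} (hC : ∀ w, |g w| ≤ C) :
    Integrable (fun w => g w * sectionDensity v w) muChart := by
  refine Integrable.of_bound (hg.mul (continuous_sectionDensity v)).aestronglyMeasurable
    (C * ((m + 1) * ‖v‖ ^ 2)) (Eventually.of_forall fun w => ?_)
  rw [norm_mul, Real.norm_eq_abs, Real.norm_of_nonneg (sectionDensity_nonneg v w)]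
  exact mul_le_mul (hC w) (sectionDensity_le v w) (sectionDensity_nonneg v w)
    ((abs_nonneg _).trans (hC w))

lemma integral_sectionDensity {m : ℕ} (v : holomorphicSections m) :
    ∫ w, sectionDensity v w ∂muChart = ‖v‖ ^ 2 := by
  simp only [sectionDensity]
  rw [← integral_sectionMeasure_eq_muChart m fun w => ‖evalSection m w v‖ ^ 2]
  have h := inner_self_eq_norm_sq_to_K (𝕜 := ℂ) (v : SectionsL2 m)
  rw [L2.inner_def] at h
  have h2 : ∫ w, inner ℂ ((v : SectionsL2 m) w) ((v : SectionsL2 m) w) ∂(sectionMeasure m) =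
      ((∫ w, ‖evalSection m w v‖ ^ 2 ∂(sectionMeasure m) : ℝ) : ℂ) := by
    rw [← integral_complex_ofReal]
    refine integral_congr_ae ?_
    filter_upwards [coeFn_eq_evalSection v] with w hw
    rw [hw, inner_self_eq_norm_sq_to_K]
    simp
  rw [h2] at h
  refine Complex.ofReal_injective (h.trans ?_)
  push_cast
  rfl

lemma inner_toeplitz_self {f : CP1 → ℝ} (hf : IsSmooth f) {m : ℕ} (v : holomorphicSections m) :
    inner ℂ v (toeplitz hf m v) =
      ((∫ w, f (chart₀ w) * sectionDensity v w ∂muChart : ℝ) : ℂ) := by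
  have h1 : inner ℂ v (toeplitz hf m v) =
      inner ℂ (v : SectionsL2 m) (mulOperator hf m (v : SectionsL2 m)) := by
    simp [toeplitz]
  have h2 : ∫ w, f (chart₀ w) * sectionDensity v w ∂muChart =
      ∫ w, f (chart₀ w) * ‖evalSection m w v‖ ^ 2 ∂(sectionMeasure m) := by
    rw [integral_sectionMeasure_eq_muChart]
    simp only [sectionDensity, mul_assoc]
  rw [h1, h2, L2.inner_def, ← integral_complex_ofReal]
  refine integral_congr_ae ?_
  filter_upwards [coeFn_eq_evalSection v, (hf.memLp_mul (v : SectionsL2 m)).coeFn_toLp] with w hw hm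
  change inner ℂ ((v : SectionsL2 m) w) ((hf.memLp_mul (v : SectionsL2 m)).toLp _ w) = _
  rw [hm, hw, RCLike.inner_apply, mul_assoc, Complex.mul_conj, Complex.normSq_eq_norm_sq]
  push_cast
  rfl

/-! ### Eigensections and the Berezin transform -/

/-- An orthonormal basis of eigensections of `T_fᵐ`. -/
def eigensection {f : CP1 → ℝ} (hf : IsSmooth f) (m : ℕ) :
    OrthonormalBasis (Fin (m + 1)) ℂ (holomorphicSections m) :=
  (isSymmetric_toeplitz hf m).eigenvectorBasis (finrank_holomorphicSections m)

lemma antitone_toeplitzEigenvalues {f : CP1 → ℝ} (hf : IsSmooth f) (m : ℕ) :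
    Antitone (toeplitzEigenvalues hf m) :=
  (isSymmetric_toeplitz hf m).eigenvalues_antitone (finrank_holomorphicSections m)

lemma toeplitz_eigensection {f : CP1 → ℝ} (hf : IsSmooth f) (m : ℕ) (k : Fin (m + 1)) :
    toeplitz hf m (eigensection hf m k) =
      (toeplitzEigenvalues hf m k : ℂ) • eigensection hf m k :=
  (isSymmetric_toeplitz hf m).apply_eigenvectorBasis (finrank_holomorphicSections m) k

lemma toeplitzEigenvalues_eq_integral {f : CP1 → ℝ} (hf : IsSmooth f) (m : ℕ) (k : Fin (m + 1)) :
    toeplitzEigenvalues hf m k =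
      ∫ w, f (chart₀ w) * sectionDensity (eigensection hf m k) w ∂muChart := by
  have h := inner_toeplitz_self hf (eigensection hf m k)
  rw [toeplitz_eigensection, inner_smul_right (y := eigensection hf m k), inner_self_eq_norm_sq_to_K,
    (eigensection hf m).norm_eq_one] at h
  have h2 : (toeplitzEigenvalues hf m k : ℂ) =
      ((∫ w, f (chart₀ w) * sectionDensity (eigensection hf m k) w ∂muChart : ℝ) : ℂ) := by
    simpa using h
  exact_mod_cast h2

/-- Parseval for the kernel section at `w`: its squared norm is exactly inverse to the weight, up to
a constant. -/
lemma sum_sectionDensity_eigensection {f : CP1 → ℝ} (hf : IsSmooth f) (m : ℕ) (w : ℂ) :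
    ∑ k, sectionDensity (eigensection hf m k) w = m + 1 := by
  have hpi := Real.pi_pos
  simp only [sectionDensity, ← inner_kernelSection]
  rw [← Finset.sum_mul, (eigensection hf m).sum_sq_norm_inner_left, norm_kernelSection_sq]
  field_simp

/-- The Berezin kernel `(m + 1) (|1 + w̄ z|² / ((1 + |w|²) (1 + |z|²)))ᵐ`. -/
def berezinKernel (m : ℕ) (w z : ℂ) : ℝ :=
  (m + 1) * (‖1 + conj w * z‖ ^ 2 / ((1 + ‖w‖ ^ 2) * (1 + ‖z‖ ^ 2))) ^ m

lemma sectionDensity_kernelSection (m : ℕ) (w z : ℂ) :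
    sectionDensity (kernelSection m w) z =
      (m + 1) / (2 * Real.pi) * (1 + ‖w‖ ^ 2) ^ m * berezinKernel m w z := by
  have hpi := Real.pi_pos
  rw [sectionDensity, evalSection_kernelSection, berezinKernel]
  have h : ‖((m : ℂ) + 1) / (2 * Real.pi) * (1 + conj w * z) ^ m‖ =
      (m + 1) / (2 * Real.pi) * ‖1 + conj w * z‖ ^ m := by
    rw [norm_mul, norm_pow, show ((m : ℂ) + 1) / (2 * Real.pi) =
      (((m + 1) / (2 * Real.pi) : ℝ) : ℂ) by push_cast; rfl, Complex.norm_real,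
      Real.norm_of_nonneg (by positivity)]
  rw [h, div_pow, mul_pow (1 + ‖w‖ ^ 2), ← pow_mul, mul_comm 2 m, pow_mul]
  field_simp

/-- The Berezin kernel is the density of the kernel section divided by its squared norm. -/
lemma integral_berezinKernel (m : ℕ) (w : ℂ) : ∫ z, berezinKernel m w z ∂muChart = 1 := by
  have hpi := Real.pi_pos
  have h := integral_sectionDensity (kernelSection m w)
  simp only [sectionDensity_kernelSection] at h
  rw [integral_const_mul, norm_kernelSection_sq] at h
  exact mul_left_cancel₀ (by positivity) (h.trans (mul_one _).symm)

/-- Both sides compute the quadratic form of the Toeplitz operator at the kernel section, once in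
the eigenbasis and once as an integral of `f`. -/
lemma sum_toeplitzEigenvalues_mul_sectionDensity {f : CP1 → ℝ} (hf : IsSmooth f) (m : ℕ) (w : ℂ) :
    ∑ k, toeplitzEigenvalues hf m k * sectionDensity (eigensection hf m k) w =
      (m + 1) * ∫ z, f (chart₀ z) * berezinKernel m w z ∂muChart := by
  have hpi := Real.pi_pos
  have h1 : inner ℂ (kernelSection m w) (toeplitz hf m (kernelSection m w)) =
      ((∑ k, toeplitzEigenvalues hf m k * ‖evalSection m w (eigensection hf m k)‖ ^ 2 : ℝ) : ℂ) := by
    rw [← (eigensection hf m).sum_inner_mul_inner, Complex.ofReal_sum]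
    refine Finset.sum_congr rfl fun k _ => ?_
    rw [← isSymmetric_toeplitz hf m, toeplitz_eigensection, inner_smul_left (x := eigensection hf m k),
      ← inner_conj_symm (eigensection hf m k), inner_kernelSection, Complex.conj_ofReal,
      mul_left_comm, Complex.mul_conj, Complex.normSq_eq_norm_sq]
    push_cast
    rfl
  rw [inner_toeplitz_self] at h1
  have h2 := Complex.ofReal_injective h1
  simp only [sectionDensity_kernelSection] at h2
  simp only [sectionDensity, ← mul_assoc]
  rw [← Finset.sum_mul, ← h2, ← integral_const_mul, ← integral_mul_const]
  refine integral_congr_ae (Eventually.of_forall fun z => ?_)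
  simp only
  field_simp

/-! ### Convergence of the Berezin transform -/

lemma norm_one_add_conj_mul_sq (w z : ℂ) :
    ‖1 + conj w * z‖ ^ 2 = (1 + ‖w‖ ^ 2) * (1 + ‖z‖ ^ 2) - ‖z - w‖ ^ 2 := by
  simp only [← Complex.normSq_eq_norm_sq, Complex.normSq_apply, Complex.add_re, Complex.add_im,
    Complex.mul_re, Complex.mul_im, Complex.conj_re, Complex.conj_im, Complex.one_re,
    Complex.one_im, Complex.sub_re, Complex.sub_im]
  ring

lemma berezinKernel_nonneg (m : ℕ) (w z : ℂ) : 0 ≤ berezinKernel m w z := by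
  rw [berezinKernel]
  positivity

lemma integrable_berezinKernel (m : ℕ) (w : ℂ) : Integrable (berezinKernel m w) muChart :=
  integrable_of_integral_eq_one (integral_berezinKernel m w)

/-- The base of the power is `1` minus a squared chordal distance, which stays bounded away from `0`
off a disc around `w`, even as `z` goes to infinity. -/
lemma exists_berezinKernel_le (w : ℂ) {r : ℝ} (hr : 0 < r) :
    ∃ ρ : ℝ, 0 ≤ ρ ∧ ρ < 1 ∧
      ∀ (m : ℕ) (z : ℂ), r ≤ ‖z - w‖ → berezinKernel m w z ≤ (m + 1) * ρ ^ m := by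
  set a : ℝ := 1 + 2 * ‖w‖ ^ 2 with ha
  have hb : ∀ z : ℂ, r ≤ ‖z - w‖ → ‖1 + conj w * z‖ ^ 2 / ((1 + ‖w‖ ^ 2) * (1 + ‖z‖ ^ 2)) ≤
      1 - r ^ 2 / ((1 + ‖w‖ ^ 2) * (a + 2 * r ^ 2)) := by
    intro z hz
    have hz2 : 1 + ‖z‖ ^ 2 ≤ a + 2 * ‖z - w‖ ^ 2 := by
      have h1 : ‖z‖ ≤ ‖z - w‖ + ‖w‖ := by simpa using norm_add_le (z - w) w
      have h2 := pow_le_pow_left₀ (norm_nonneg z) h1 2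
      nlinarith [sq_nonneg (‖z - w‖ - ‖w‖)]
    have hr2 : r ^ 2 ≤ ‖z - w‖ ^ 2 := pow_le_pow_left₀ hr.le hz 2
    rw [norm_one_add_conj_mul_sq, sub_div, div_self (by positivity)]
    refine sub_le_sub_left ?_ 1
    -- By `hz2` the right side is at least `x / (a + 2x)` with `x = ‖z - w‖²`, which increases in
    -- `x`.
    have h3 : r ^ 2 / (a + 2 * r ^ 2) ≤ ‖z - w‖ ^ 2 / (1 + ‖z‖ ^ 2) := by
      rw [div_le_div_iff₀ (by positivity) (by positivity)]
      have ha0 : 0 ≤ a := by positivity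
      nlinarith [mul_le_mul_of_nonneg_left hz2 (sq_nonneg r), mul_le_mul_of_nonneg_left hr2 ha0]
    rw [mul_comm (1 + ‖w‖ ^ 2), mul_comm (1 + ‖w‖ ^ 2), ← div_div, ← div_div]
    exact div_le_div_of_nonneg_right h3 (by positivity)
  refine ⟨1 - r ^ 2 / ((1 + ‖w‖ ^ 2) * (a + 2 * r ^ 2)), ?_, ?_, fun m z hz => ?_⟩
  -- Nonnegativity of `ρ` follows because it dominates a nonnegative ratio at a point at distance
  -- exactly `r`.
  · refine le_trans ?_ (hb (w + r) (by simp [abs_of_pos hr]))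
    positivity
  · have : 0 < r ^ 2 / ((1 + ‖w‖ ^ 2) * (a + 2 * r ^ 2)) := by positivity
    linarith
  · rw [berezinKernel]
    exact mul_le_mul_of_nonneg_left (pow_le_pow_left₀ (by positivity) (hb z hz) m) (by positivity)

lemma integrable_mul_berezinKernel {g : ℂ → ℝ} (hg : Continuous g) {C : ℝ} (hC : ∀ z, |g z| ≤ C)
    (m : ℕ) (w : ℂ) : Integrable (fun z => g z * berezinKernel m w z) muChart :=
  (integrable_berezinKernel m w).bdd_mul hg.aestronglyMeasurable (Eventually.of_forall hC)

/-- The Berezin transform of `g`. -/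
def berezinTransform (g : ℂ → ℝ) (m : ℕ) (w : ℂ) : ℝ :=
  ∫ z, g z * berezinKernel m w z ∂muChart

lemma abs_berezinTransform_le {g : ℂ → ℝ} (hg : Continuous g) {C : ℝ} (hC : ∀ z, |g z| ≤ C)
    (m : ℕ) (w : ℂ) : |berezinTransform g m w| ≤ C := by
  refine (abs_integral_le_integral_abs).trans ?_
  refine (integral_mono (integrable_mul_berezinKernel hg hC m w).abs
    ((integrable_berezinKernel m w).const_mul C) fun z => ?_).trans_eq ?_
  · simp only
    rw [abs_mul, abs_of_nonneg (berezinKernel_nonneg m w z)]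
    exact mul_le_mul_of_nonneg_right (hC z) (berezinKernel_nonneg m w z)
  · rw [integral_const_mul, integral_berezinKernel, mul_one]

lemma tendsto_berezinTransform {g : ℂ → ℝ} (hg : Continuous g) {C : ℝ} (hC : ∀ z, |g z| ≤ C)
    (w : ℂ) : Tendsto (fun m => berezinTransform g m w) atTop (𝓝 (g w)) := by
  rw [Metric.tendsto_atTop]
  intro ε hε
  obtain ⟨r, hr, hgr⟩ := Metric.continuousAt_iff.1 (hg.continuousAt (x := w)) (ε / 2) (half_pos hε)
  obtain ⟨ρ, hρ0, hρ1, hρ⟩ := exists_berezinKernel_le w hr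
  have hC0 : 0 ≤ C := (abs_nonneg _).trans (hC w)
  have hlim : Tendsto (fun m : ℕ => 2 * C * (((m : ℝ) + 1) * ρ ^ m)) atTop (𝓝 0) := by
    have h1 := (tendsto_self_mul_const_pow_of_lt_one hρ0 hρ1).add
      (tendsto_pow_atTop_nhds_zero_of_lt_one hρ0 hρ1)
    simpa [add_mul] using h1.const_mul (2 * C)
  obtain ⟨M, hM⟩ := eventually_atTop.1 (hlim.eventually_lt_const (half_pos hε))
  refine ⟨M, fun m hm => ?_⟩
  have hK := integrable_berezinKernel m w
  have hgK := integrable_mul_berezinKernel hg hC m w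
  have hdiff : berezinTransform g m w - g w =
      ∫ z, (g z * berezinKernel m w z - g w * berezinKernel m w z) ∂muChart := by
    rw [integral_sub hgK (hK.const_mul _), integral_const_mul, integral_berezinKernel, mul_one,
      berezinTransform]
  rw [Real.dist_eq, hdiff]
  -- The first term handles `z` near `w` by continuity, the second the rest by kernel decay; adding
  -- both gives one bound for all `z`, so the domain need not be split.
  have hbound : ∀ z, |g z * berezinKernel m w z - g w * berezinKernel m w z| ≤
      ε / 2 * berezinKernel m w z + 2 * C * ((m + 1) * ρ ^ m) := by
    intro z
    have hK0 := berezinKernel_nonneg m w z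
    rw [← sub_mul, abs_mul, abs_of_nonneg hK0]
    rcases lt_or_ge ‖z - w‖ r with h | h
    · have h1 : |g z - g w| ≤ ε / 2 := (hgr (by rwa [dist_eq_norm])).le
      have h2 : 0 ≤ 2 * C * ((m + 1) * ρ ^ m) := by positivity
      linarith [mul_le_mul_of_nonneg_right h1 hK0]
    · have h1 : |g z - g w| ≤ 2 * C := by linarith [abs_sub (g z) (g w), hC z, hC w]
      have h2 := mul_le_mul h1 (hρ m z h) hK0 (by positivity)
      have h3 : 0 ≤ ε / 2 * berezinKernel m w z := by positivity
      linarith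
  calc _ ≤ ∫ z, |g z * berezinKernel m w z - g w * berezinKernel m w z| ∂muChart :=
        abs_integral_le_integral_abs
    _ ≤ ∫ z, (ε / 2 * berezinKernel m w z + 2 * C * ((m + 1) * ρ ^ m)) ∂muChart :=
        integral_mono (hgK.sub (hK.const_mul _)).abs ((hK.const_mul _).add (integrable_const _))
          hbound
    _ = ε / 2 + 2 * C * ((m + 1) * ρ ^ m) := by
        rw [integral_add (hK.const_mul _) (integrable_const _), integral_const_mul,
          integral_berezinKernel]
        simp
    _ < ε := by linarith [hM m hm]

/-! ### The Berezin–Lieb inequalities -/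

section BerezinLieb

variable {f : CP1 → ℝ} (hf : IsSmooth f)

lemma integral_sectionDensity_eigensection (m : ℕ) (k : Fin (m + 1)) :
    ∫ w, sectionDensity (eigensection hf m k) w ∂muChart = 1 := by
  rw [integral_sectionDensity, (eigensection hf m).norm_eq_one, one_pow]

lemma integrable_sectionDensity {m : ℕ} (v : holomorphicSections m) :
    Integrable (sectionDensity v) muChart := by
  simpa using integrable_mul_sectionDensity v (g := fun _ => 1) continuous_const (C := 1) (by simp)

lemma abs_max_sub_le {x C : ℝ} (hx : |x| ≤ C) (c : ℝ) : |max (x - c) 0| ≤ C + |c| := by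
  rw [abs_of_nonneg (le_max_right _ _)]
  refine max_le ?_ ((abs_nonneg _).trans (hx.trans (le_add_of_nonneg_right (abs_nonneg c))))
  linarith [le_abs_self x, neg_abs_le c]

/-- Jensen for `(· - c)₊` against the probability density of each eigensection; summing over `k`
replaces the densities by `m + 1`. -/
lemma meanExcess_toeplitzEigenvalues_le (m : ℕ) (c : ℝ) :
    meanExcess (toeplitzEigenvalues hf m) c ≤ ∫ w, max (f (chart₀ w) - c) 0 ∂muChart := by
  obtain ⟨C, hC⟩ := hf.exists_bound
  have hg : Continuous fun w => f (chart₀ w) := hf.1.continuous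
  have hφ : Continuous fun w => max (f (chart₀ w) - c) 0 :=
    (hg.sub continuous_const).max continuous_const
  have hφi : ∀ k, Integrable (fun w => max (f (chart₀ w) - c) 0 *
      sectionDensity (eigensection hf m k) w) muChart := fun k =>
    integrable_mul_sectionDensity _ hφ fun w => abs_max_sub_le (hC w) c
  have hk : ∀ k, max (toeplitzEigenvalues hf m k - c) 0 ≤
      ∫ w, max (f (chart₀ w) - c) 0 * sectionDensity (eigensection hf m k) w ∂muChart := by
    intro k
    refine max_le ?_ (integral_nonneg fun w =>
      mul_nonneg (le_max_right _ _) (sectionDensity_nonneg _ _))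
    have h1 := integrable_mul_sectionDensity (eigensection hf m k) hg hC
    have h2 := (integrable_sectionDensity (eigensection hf m k)).const_mul c
    have h3 : toeplitzEigenvalues hf m k - c =
        ∫ w, (f (chart₀ w) * sectionDensity (eigensection hf m k) w -
          c * sectionDensity (eigensection hf m k) w) ∂muChart := by
      rw [integral_sub h1 h2, integral_const_mul, integral_sectionDensity_eigensection, mul_one,
        ← toeplitzEigenvalues_eq_integral]
    rw [h3]
    refine integral_mono (h1.sub h2) (hφi k) fun w => ?_
    simp only [← sub_mul]
    exact mul_le_mul_of_nonneg_right (le_max_left _ _) (sectionDensity_nonneg _ _)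
  rw [meanExcess, div_le_iff₀ (by positivity)]
  refine (Finset.sum_le_sum fun k _ => hk k).trans_eq ?_
  rw [← integral_finsetSum _ fun k _ => hφi k, ← integral_mul_const]
  simp only [← Finset.mul_sum, sum_sectionDensity_eigensection]

lemma berezinTransform_eq (m : ℕ) (w : ℂ) :
    berezinTransform (fun z => f (chart₀ z)) m w =
      (∑ k, toeplitzEigenvalues hf m k * sectionDensity (eigensection hf m k) w) / (m + 1) := by
  rw [sum_toeplitzEigenvalues_mul_sectionDensity, mul_div_cancel_left₀ _ (by positivity),
    berezinTransform]

/-- The finite spectral sum makes continuity immediate, with no differentiation or limit under the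
integral. -/
lemma continuous_berezinTransform (hf : IsSmooth f) (m : ℕ) :
    Continuous (berezinTransform (fun z => f (chart₀ z)) m) := by
  have h : berezinTransform (fun z => f (chart₀ z)) m = fun w =>
      (∑ k, toeplitzEigenvalues hf m k * sectionDensity (eigensection hf m k) w) / (m + 1) :=
    funext (berezinTransform_eq hf m)
  rw [h]
  exact (continuous_finsetSum _ fun k _ =>
    continuous_const.mul (continuous_sectionDensity _)).div_const _

/-- Jensen in the other direction: at fixed `w` the densities divided by `m + 1` are probability
weights on the spectrum, and each density integrates to `1` in `w`. -/
lemma integral_berezinTransform_le (m : ℕ) (c : ℝ) :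
    ∫ w, max (berezinTransform (fun z => f (chart₀ z)) m w - c) 0 ∂muChart ≤
      meanExcess (toeplitzEigenvalues hf m) c := by
  obtain ⟨C, hC⟩ := hf.exists_bound
  have hg : Continuous fun w => f (chart₀ w) := hf.1.continuous
  have hi : ∀ k, Integrable (fun w => max (toeplitzEigenvalues hf m k - c) 0 *
      sectionDensity (eigensection hf m k) w) muChart := fun k =>
    (integrable_sectionDensity _).const_mul _
  have hle : ∀ w, max (berezinTransform (fun z => f (chart₀ z)) m w - c) 0 ≤
      (∑ k, max (toeplitzEigenvalues hf m k - c) 0 *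
        sectionDensity (eigensection hf m k) w) / (m + 1) := by
    intro w
    refine max_le ?_ (div_nonneg (Finset.sum_nonneg fun k _ =>
      mul_nonneg (le_max_right _ _) (sectionDensity_nonneg _ _)) (by positivity))
    rw [berezinTransform_eq hf, sub_le_iff_le_add, div_le_iff₀ (by positivity), add_mul,
      div_mul_cancel₀ _ (by positivity), ← sum_sectionDensity_eigensection hf m w, Finset.mul_sum,
      ← Finset.sum_add_distrib]
    refine Finset.sum_le_sum fun k _ => ?_
    rw [← add_mul]
    refine mul_le_mul_of_nonneg_right ?_ (sectionDensity_nonneg _ _)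
    linarith [le_max_left (toeplitzEigenvalues hf m k - c) 0]
  refine (integral_mono ?_ ((integrable_finsetSum _ fun k _ => hi k).div_const _) hle).trans_eq ?_
  · exact Integrable.of_bound (((continuous_berezinTransform hf m).sub continuous_const).max
      continuous_const).aestronglyMeasurable (C + |c|)
      (Eventually.of_forall fun w => abs_max_sub_le (abs_berezinTransform_le hg hC m w) c)
  · rw [integral_div, integral_finsetSum _ fun k _ => hi k, meanExcess]
    simp only [integral_const_mul, integral_sectionDensity_eigensection, mul_one]

lemma tendsto_meanExcess_toeplitzEigenvalues (c : ℝ) :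
    Tendsto (fun m => meanExcess (toeplitzEigenvalues hf m) c) atTop
      (𝓝 (∫ w, max (f (chart₀ w) - c) 0 ∂muChart)) := by
  obtain ⟨C, hC⟩ := hf.exists_bound
  have hg : Continuous fun w => f (chart₀ w) := hf.1.continuous
  refine tendsto_of_tendsto_of_tendsto_of_le_of_le ?_ tendsto_const_nhds
    (fun m => integral_berezinTransform_le hf m c)
    (fun m => meanExcess_toeplitzEigenvalues_le hf m c)
  refine tendsto_integral_of_dominated_convergence (fun _ => C + |c|) (fun m => ?_)
    (integrable_const _)
    (fun m => Eventually.of_forall fun w => abs_max_sub_le (abs_berezinTransform_le hg hC m w) c)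
    (Eventually.of_forall fun w => ?_)
  · exact (((continuous_berezinTransform hf m).sub continuous_const).max
      continuous_const).aestronglyMeasurable
  · exact ((tendsto_berezinTransform hg hC w).sub_const c).max tendsto_const_nhds

end BerezinLieb

/-! ### Smooth functions on the Riemann sphere -/

lemma chart₀_div (v : Fin 2 → ℂ) (hv : v ≠ 0) (h : v 0 ≠ 0) :
    chart₀ (v 1 / v 0) = Projectivization.mk ℂ v hv := by
  rw [chart₀, Projectivization.mk_eq_mk_iff']
  refine ⟨(v 0)⁻¹, ?_⟩
  ext i
  fin_cases i
  · simp [h]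
  · simp [div_eq_inv_mul]

lemma chart₁_div (v : Fin 2 → ℂ) (hv : v ≠ 0) (h : v 1 ≠ 0) :
    chart₁ (v 0 / v 1) = Projectivization.mk ℂ v hv := by
  rw [chart₁, Projectivization.mk_eq_mk_iff']
  refine ⟨(v 1)⁻¹, ?_⟩
  ext i
  fin_cases i
  · simp [div_eq_inv_mul]
  · simp [h]

lemma apply_zero_ne_zero_or {v : Fin 2 → ℂ} (hv : v ≠ 0) : v 0 ≠ 0 ∨ v 1 ≠ 0 := by
  by_contra! h
  refine hv (funext fun i => ?_)
  fin_cases i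
  · exact h.1
  · exact h.2

/-- Continuity is tested on `ℂ² ∖ {0}`, where near each vector one of the two coordinate ratios is
defined and `f` factors through that chart. -/
lemma IsSmooth.continuous {f : CP1 → ℝ} (hf : IsSmooth f) : Continuous f := by
  have hq : Topology.IsQuotientMap
      (fun v : {v : Fin 2 → ℂ // v ≠ 0} => (Projectivization.mk ℂ v.1 v.2 : CP1)) :=
    isQuotientMap_quotient_mk'
  rw [hq.continuous_iff, continuous_iff_continuousAt]
  intro v
  have hc : ∀ i, Continuous fun v : {v : Fin 2 → ℂ // v ≠ 0} => v.1 i := fun i =>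
    (continuous_apply i).comp continuous_subtype_val
  rcases apply_zero_ne_zero_or v.2 with h | h
  · have h1 : ContinuousAt (fun v : {v : Fin 2 → ℂ // v ≠ 0} => f (chart₀ (v.1 1 / v.1 0))) v :=
      hf.1.continuous.continuousAt.comp
        (f := fun v : {v : Fin 2 → ℂ // v ≠ 0} => v.1 1 / v.1 0)
        ((hc 1).continuousAt.div (hc 0).continuousAt h)
    refine h1.congr ?_
    filter_upwards [(hc 0).continuousAt.eventually_ne h] with u hu
    simp [chart₀_div u.1 u.2 hu]
  · have h1 : ContinuousAt (fun v : {v : Fin 2 → ℂ // v ≠ 0} => f (chart₁ (v.1 0 / v.1 1))) v :=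
      hf.2.continuous.continuousAt.comp
        (f := fun v : {v : Fin 2 → ℂ // v ≠ 0} => v.1 0 / v.1 1)
        ((hc 0).continuousAt.div (hc 1).continuousAt h)
    refine h1.congr ?_
    filter_upwards [(hc 1).continuousAt.eventually_ne h] with u hu
    simp [chart₁_div u.1 u.2 hu]

lemma IsSmooth.exists_forall_abs_le {f : CP1 → ℝ} (hf : IsSmooth f) : ∃ C : ℝ, ∀ x, |f x| ≤ C := by
  obtain ⟨C, hC⟩ := hf.exists_bound
  -- The bound `C` covers only the first chart; the one missing point is `chart₁ 0`.
  refine ⟨max C |f (chart₁ 0)|, fun x => ?_⟩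
  induction x using Projectivization.ind with | h v hv =>
  by_cases h : v 0 = 0
  · rw [← chart₁_div v hv ((apply_zero_ne_zero_or hv).resolve_left (not_not.2 h)), h, zero_div]
    exact le_max_right _ _
  · rw [← chart₀_div v hv h]
    exact (hC _).trans (le_max_left _ _)

end ToeplitzCP1

end

theorem theoremt (f : ToeplitzCP1.CP1 → ℝ) (hf : ToeplitzCP1.IsSmooth f) :
    ∀ᵐ s : ℝ ∂(volume.restrict (Set.Ico (0 : ℝ) 1)),
      Tendsto (fun m : ℕ => ToeplitzCP1.stepFunction (ToeplitzCP1.toeplitzEigenvalues hf m) s)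
        atTop (𝓝 (ToeplitzCP1.decreasingRearrangement ToeplitzCP1.mu f s)) := by
  obtain ⟨C, hC⟩ := hf.exists_forall_abs_le
  refine ToeplitzCP1.ae_tendsto_stepFunction hf.continuous.measurable hC
    (ToeplitzCP1.antitone_toeplitzEigenvalues hf) fun c => ?_
  have hc : Continuous fun x => max (f x - c) 0 :=
    (hf.continuous.sub continuous_const).max continuous_const
  rw [ToeplitzCP1.mu_eq_map, integral_map ToeplitzCP1.measurable_chart₀.aemeasurable
    hc.measurable.aestronglyMeasurable]
  exact ToeplitzCP1.tendsto_meanExcess_toeplitzEigenvalues hf c
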